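/- Let $M=\{A,B,C\}$ and let $V$ be the set of injective functions $u:M\to[0,1]$ with $0$ and $1$ in their image. For $n\ge 1$, a mechanism for $n$ voters is a map $J$ from $V^n$ to the set of probability distributions on $M$. Its approximation ratio is \[ \mathrm{ratio}(J)=\inf_{\mathbf u\in V^n}\frac{\mathbb E_{j\sim J(\mathbf u)}\bigl[\sum_{i=1}^n u_i(j)\bigr]}{\max_{j\in M}\sum_{i=1}^n u_i(j)}. \] $J$ is truthful if $\mathbb E[u_i(J(u_i,u_{-i}))]\ge \mathbb E[u_i(J(v,u_{-i}))]$ for every voter $i$, every $\mathbf u\in V^n$ and every $v\in V$; it is ordinal if $J(u_i,u_{-i})=J(v,u_{-i})$ whenever $u_i$ and $v$ induce the same ranking of $M$. Random-favorite selects a voter uniformly at random and elects his most preferred candidate. Quadratic-lottery $Q_n$ selects one of the $n$ voters uniformly at random and, with $\alpha$ his valuation of his second most preferred candidate, elects his most, second most and least preferred candidate with probability $(4-\alpha^2)/6$, $(1+2\alpha)/6$ and $(1-2\alpha+\alpha^2)/6$, respectively. Let $J_n$ be the mechanism for $n$ voters that runs random-favorite with probability $29/100$ and $Q_n$ with probability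 $71/100$. Then: 1. $\lim_{n\to\infty}\mathrm{ratio}(Q_n)=\frac{\sqrt5-1}{2}$. 2. For every $n\ge1$, $J_n$ is truthful and $\mathrm{ratio}(J_n)>\frac{33}{50}=0.660$. 3. Consequently $J_n$ beats all truthful ordinal mechanisms when there are sufficiently many voters: there are $\delta>0$ and $N$ such that for every $n\ge N$ and every truthful ordinal mechanism $J$ for $n$ voters, $\mathrm{ratio}(J)+\delta\le\mathrm{ratio}(J_n)$. -/

import Mathlib

open Filter Topology

noncomputable section

namespace Voting

/-- Canonically represented valuation functions on `m` candidates: injective functions into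
`[0,1]` with both `0` and `1` in the image. -/
def Valuation (m : ℕ) : Type :=
  {u : Fin m → ℝ // Function.Injective u ∧ (∀ j, u j ∈ Set.Icc (0 : ℝ) 1) ∧
    0 ∈ Set.range u ∧ 1 ∈ Set.range u}

instance (m : ℕ) : CoeFun (Valuation m) (fun _ => Fin m → ℝ) := ⟨Subtype.val⟩

/-- A valuation profile of `n` voters. -/
abbrev Profile (m n : ℕ) : Type := Fin n → Valuation m

/-- Lotteries (probability vectors) on the `m` candidates. -/
abbrev Lottery (m : ℕ) : Type := stdSimplex ℝ (Fin m)

/-- A randomized mechanism, viewed as a map from profiles to lotteries. -/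
abbrev Mechanism (m n : ℕ) : Type := Profile m n → Lottery m

/-- The expected value of the function `w` on candidates under the lottery `p`. -/
def expect {m : ℕ} (p : Lottery m) (w : Fin m → ℝ) : ℝ := ∑ j, p.1 j * w j

/-- The social welfare of candidate `j`. -/
def welfare {m n : ℕ} (u : Profile m n) (j : Fin m) : ℝ := ∑ i, u i j

/-- The approximation ratio: infimum over all profiles of expected social welfare divided by
the optimal social welfare. -/
def ratio {m n : ℕ} (J : Mechanism m n) : ℝ :=
  ⨅ u : Profile m n, expect (J u) (welfare u) / ⨆ j : Fin m, welfare u j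

/-- Truthfulness in expectation. -/
def Truthful {m n : ℕ} (J : Mechanism m n) : Prop :=
  ∀ (i : Fin n) (u : Profile m n) (v : Valuation m),
    expect (J (Function.update u i v)) (u i) ≤ expect (J u) (u i)

/-- Ordinal mechanisms: the lottery does not change if a voter replaces his valuation by one that
ranks the candidates in the same way. -/
def Ordinal {m n : ℕ} (J : Mechanism m n) : Prop :=
  ∀ (i : Fin n) (u : Profile m n) (v : Valuation m),
    (∀ j k, u i j < u i k ↔ v j < v k) → J (Function.update u i v) = J u

/-- The position of candidate `j` on the ballot `u`: the number of candidates that are strictly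
preferred to `j`. So `0` is the most preferred candidate, `1` the second most preferred one. -/
def position {m : ℕ} (u : Valuation m) (j : Fin m) : ℕ :=
  (Finset.univ.filter fun k => u j < u k).card

theorem position_lt {m : ℕ} (u : Valuation m) (j : Fin m) : position u j < m := by
  have h : (Finset.univ.filter fun k => u j < u k).card < (Finset.univ : Finset (Fin m)).card :=
    Finset.card_lt_card (Finset.filter_ssubset.2 ⟨j, Finset.mem_univ j, lt_irrefl _⟩)
  simpa [position] using h

theorem position_lt_position {m : ℕ} (u : Valuation m) {j k : Fin m} (h : u j < u k) :
    position u k < position u j := by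
  refine Finset.card_lt_card (Finset.ssubset_iff_of_subset ?_ |>.2 ⟨k, ?_, ?_⟩)
  · intro l hl
    simp only [Finset.mem_filter, Finset.mem_univ, true_and] at hl ⊢
    exact h.trans hl
  · simpa using h
  · simp

theorem position_injective {m : ℕ} (u : Valuation m) : Function.Injective (position u) := by
  intro j k h
  by_contra hne
  rcases lt_or_gt_of_ne (fun e => hne (u.2.1 e)) with hlt | hlt
  · exact absurd h (position_lt_position u hlt).ne'
  · exact absurd h (position_lt_position u hlt).ne

theorem sum_position {m : ℕ} (u : Valuation m) (g : ℕ → ℝ) :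
    ∑ j, g (position u j) = ∑ k ∈ Finset.range m, g k := by
  have hb : Function.Bijective (fun j => (⟨position u j, position_lt u j⟩ : Fin m)) :=
    Finite.injective_iff_bijective.1 fun j k h => position_injective u (Fin.mk.inj h)
  rw [Finset.sum_range]
  exact hb.sum_comp (fun k : Fin m => g k)

/-- Elect the candidate at position `0` of the ballot. -/
def favorite {m : ℕ} [NeZero m] (u : Valuation m) : Lottery m :=
  ⟨fun j => if position u j = 0 then 1 else 0,
    fun j => by dsimp only; split_ifs <;> norm_num,
    by
      rw [sum_position u (fun p => if p = 0 then 1 else 0)]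
      simp [NeZero.pos m]⟩

/-- The valuation of the second most preferred candidate of a ballot on three candidates
(exactly one summand has position `1`). -/
def secondValue (u : Valuation 3) : ℝ :=
  ∑ j, if position u j = 1 then u j else 0

theorem secondValue_mem (u : Valuation 3) : secondValue u ∈ Set.Icc (0 : ℝ) 1 := by
  have h := sum_position u (fun p => if p = 1 then 1 else 0)
  simp only [Finset.sum_range_succ, Finset.sum_range_zero] at h
  constructor
  · refine Finset.sum_nonneg fun j _ => ?_
    split_ifs
    exacts [(u.2.2.1 j).1, le_rfl]
  · refine le_trans (Finset.sum_le_sum fun j _ => ?_) (h.le.trans (by norm_num))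
    show (if position u j = 1 then u j else 0) ≤ if position u j = 1 then 1 else 0
    split_ifs
    exacts [(u.2.2.1 j).2, le_rfl]

/-- Probability with which the one-voter quadratic lottery elects the candidate at position `p`
when the second most preferred candidate has valuation `a`. -/
def quadraticProb (a : ℝ) (p : ℕ) : ℝ :=
  if p = 0 then (4 - a ^ 2) / 6 else if p = 1 then (1 + 2 * a) / 6 else (1 - 2 * a + a ^ 2) / 6

/-- The quadratic lottery of one ballot. -/
def quadratic (u : Valuation 3) : Lottery 3 :=
  ⟨fun j => quadraticProb (secondValue u) (position u j),
    fun j => by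
      obtain ⟨h0, h1⟩ := secondValue_mem u
      simp only [quadraticProb]
      split_ifs
      · nlinarith
      · linarith
      · nlinarith [sq_nonneg (1 - secondValue u)],
    by
      rw [sum_position u (quadraticProb (secondValue u))]
      simp only [Finset.sum_range_succ, Finset.sum_range_zero, quadraticProb]
      norm_num
      ring⟩

/-- Select a voter uniformly at random and apply the one-voter rule `L` to his ballot. -/
def randomVoter {m : ℕ} (n : ℕ) [NeZero n] (L : Valuation m → Lottery m) : Mechanism m n :=
  fun u => ⟨fun j => (∑ i, (L (u i)).1 j) / n,
    fun j => div_nonneg (Finset.sum_nonneg fun i _ => (L (u i)).2.1 j) (Nat.cast_nonneg n),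
    by
      have hn : (n : ℝ) ≠ 0 := Nat.cast_ne_zero.2 (NeZero.ne n)
      rw [← Finset.sum_div, Finset.sum_comm, Finset.sum_congr rfl fun i _ => (L (u i)).2.2]
      simp [hn]⟩

/-- Run `J` with probability `a` and `K` with probability `b`, where `a + b = 1`. -/
def mix {m n : ℕ} (a b : ℝ) (ha : 0 ≤ a) (hb : 0 ≤ b) (hab : a + b = 1) (J K : Mechanism m n) :
    Mechanism m n :=
  fun u => ⟨a • (J u).1 + b • (K u).1, convex_stdSimplex ℝ (Fin m) (J u).2 (K u).2 ha hb hab⟩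

/-- The mechanism random-favorite. -/
def randomFavorite (m n : ℕ) [NeZero m] [NeZero n] : Mechanism m n := randomVoter n favorite

/-- The mechanism quadratic-lottery for three candidates. -/
def quadraticLottery (n : ℕ) [NeZero n] : Mechanism 3 n := randomVoter n quadratic

/-- Random-favorite with probability `29/100`, quadratic-lottery with probability `71/100`. -/
def mixedMechanism (n : ℕ) [NeZero n] : Mechanism 3 n :=
  mix (29 / 100) (71 / 100) (by norm_num) (by norm_num) (by norm_num)
    (randomFavorite 3 n) (quadraticLottery n)

end Voting

end

/-! Lower bounds. Up to an error proportional to the second value α of the ballot u, a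
quadratic-lottery ballot elects candidate j with probability u(j)/2 + 1/6. Bounding that error voter
by voter and summing, with the welfare vector as test function, turns the ratio into a quadratic
inequality in the normalized welfares a ≥ b ≥ c, where a ≤ 1 and t = a + b + c - 1 ≥ 0 is the mean
second value. For `quadraticLottery` equality holds at t = 0, b = c, a = √5/3. Profiles with second
values tending to 0 and favorites split in these proportions show that (√5 - 1)/2 is the limit. For
`mixedMechanism` the analogous inequality leaves 0.6601.

Ordinal mechanisms. Letting the second value tend to 0 or 1 in the truthfulness condition shows that
the probability of x depends only on the sets of candidates ranked above x (`Truthful.localized`).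
Let s rank 0, 1, 2 and everyone else 2, 1, 0. The probability of the middle candidate, averaged over
the three cyclic renamings, then does not depend on s (`sum_middleProb`). An even split with second
value near 1 forces this average m to be at least about 2r - 1, where r is the ratio. A 54:46 split
with second value near 0 gives r ≤ 1 - m up to rounding, hence only r ≤ 2/3. Localization also
forces a positive probability q on the candidate of the 46% side, and this extra loss pushes r below
0.6595. -/

noncomputable section

namespace Voting

/-! ### Normal form of ballots on three candidates -/

/-- The ballot with values `1`, `a`, `0` at the candidates ranked `0`, `1`, `2` by `ρ`. -/
def ballot (ρ : Equiv.Perm (Fin 3)) (a : ℝ) (h : a ∈ Set.Ioo (0 : ℝ) 1) : Valuation 3 :=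
  ⟨fun j => ![1, a, 0] (ρ j), by
    obtain ⟨h0, h1⟩ := h
    refine ⟨fun j k hjk => ρ.injective ?_, fun j => ?_, ⟨ρ.symm 2, by simp⟩, ⟨ρ.symm 0, by simp⟩⟩
    · dsimp only at hjk
      generalize ρ j = x at hjk ⊢
      generalize ρ k = y at hjk ⊢
      fin_cases x <;> fin_cases y <;> (simp at hjk ⊢; try linarith)
    · dsimp only
      generalize ρ j = x
      fin_cases x <;> simp <;> exact ⟨h0.le, h1.le⟩⟩

theorem ballot_apply (ρ : Equiv.Perm (Fin 3)) (a : ℝ) (h : a ∈ Set.Ioo (0 : ℝ) 1) (j : Fin 3) :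
    ballot ρ a h j = ![1, a, 0] (ρ j) := rfl

theorem ballot_lt_iff (ρ : Equiv.Perm (Fin 3)) (a : ℝ) (h : a ∈ Set.Ioo (0 : ℝ) 1)
    (j k : Fin 3) : ballot ρ a h j < ballot ρ a h k ↔ ρ k < ρ j := by
  have h0 := h.1
  have h1 := h.2
  rw [ballot_apply, ballot_apply]
  generalize ρ j = x
  generalize ρ k = y
  fin_cases x <;> fin_cases y <;> simp <;> linarith

theorem position_ballot (ρ : Equiv.Perm (Fin 3)) (a : ℝ) (h : a ∈ Set.Ioo (0 : ℝ) 1)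
    (j : Fin 3) : position (ballot ρ a h) j = (ρ j : ℕ) := by
  simp only [position, ballot_lt_iff]
  have : (Finset.univ.filter fun k => ρ k < ρ j) = (Finset.Iio (ρ j)).map ρ.symm.toEmbedding := by
    ext k
    simp
  rw [this, Finset.card_map, Fin.card_Iio]

theorem secondValue_ballot (ρ : Equiv.Perm (Fin 3)) (a : ℝ) (h : a ∈ Set.Ioo (0 : ℝ) 1) :
    secondValue (ballot ρ a h) = a := by
  simp only [secondValue, position_ballot, ballot_apply]
  rw [Equiv.sum_comp ρ (fun k : Fin 3 => if (k : ℕ) = 1 then (![1, a, 0] : Fin 3 → ℝ) k else 0)]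
  simp [Fin.sum_univ_three]

theorem exists_ballot (u : Valuation 3) : ∃ ρ a h, u = ballot ρ a h := by
  have hb : Function.Bijective (fun j => (⟨position u j, position_lt u j⟩ : Fin 3)) :=
    Finite.injective_iff_bijective.1 fun j k h => position_injective u (Fin.mk.inj h)
  let ρ := Equiv.ofBijective _ hb
  have hanti : ∀ j k, ρ j < ρ k → u k < u j := by
    intro j k hjk
    by_contra hcon
    rcases (not_lt.1 hcon).lt_or_eq with hlt | heq
    · exact absurd hjk (not_lt.2 (Fin.le_def.2 (position_lt_position u hlt).le))
    · rw [u.2.1 heq] at hjk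
      exact lt_irrefl _ hjk
  have h01 := hanti (ρ.symm 0) (ρ.symm 1) (by simp)
  have h12 := hanti (ρ.symm 1) (ρ.symm 2) (by simp)
  have hcov : ∀ j, j = ρ.symm 0 ∨ j = ρ.symm 1 ∨ j = ρ.symm 2 := by
    intro j
    simp only [Equiv.eq_symm_apply]
    generalize ρ j = x
    fin_cases x <;> simp
  obtain ⟨hmem, ⟨z, hz⟩, ⟨x, hx⟩⟩ := u.2.2
  have e0 : u (ρ.symm 0) = 1 := by
    have := (hmem (ρ.symm 0)).2
    rcases hcov x with rfl | rfl | rfl <;> linarith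
  have e2 : u (ρ.symm 2) = 0 := by
    have := (hmem (ρ.symm 2)).1
    rcases hcov z with rfl | rfl | rfl <;> linarith
  refine ⟨ρ, u (ρ.symm 1), ⟨by linarith, by linarith⟩, Subtype.ext (funext fun j => ?_)⟩
  change u j = ![1, u (ρ.symm 1), 0] (ρ j)
  rcases hcov j with rfl | rfl | rfl <;> simp [e0, e2]

theorem favorite_ballot (ρ : Equiv.Perm (Fin 3)) (a : ℝ) (h : a ∈ Set.Ioo (0 : ℝ) 1)
    (j : Fin 3) : (favorite (ballot ρ a h)).1 j = ![1, 0, 0] (ρ j) := by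
  simp only [favorite, position_ballot]
  generalize ρ j = x
  fin_cases x <;> simp

theorem quadratic_ballot (ρ : Equiv.Perm (Fin 3)) (a : ℝ) (h : a ∈ Set.Ioo (0 : ℝ) 1)
    (j : Fin 3) : (quadratic (ballot ρ a h)).1 j =
      ![(4 - a ^ 2) / 6, (1 + 2 * a) / 6, (1 - 2 * a + a ^ 2) / 6] (ρ j) := by
  simp only [quadratic, position_ballot, secondValue_ballot, quadraticProb]
  generalize ρ j = x
  fin_cases x <;> simp

/-! ### Truthfulness of the mixed mechanism -/

theorem expect_randomVoter {m n : ℕ} [NeZero n] (L : Valuation m → Lottery m) (u : Profile m n)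
    (w : Fin m → ℝ) :
    expect (randomVoter n L u) w = (∑ i, expect (L (u i)) w) / n := by
  simp only [expect, randomVoter]
  rw [Finset.sum_comm, Finset.sum_div]
  refine Finset.sum_congr rfl fun j _ => ?_
  rw [← Finset.sum_mul]
  ring

theorem expect_mix {m n : ℕ} (a b : ℝ) (ha : 0 ≤ a) (hb : 0 ≤ b) (hab : a + b = 1)
    (J K : Mechanism m n) (u : Profile m n) (w : Fin m → ℝ) :
    expect (mix a b ha hb hab J K u) w = a * expect (J u) w + b * expect (K u) w := by
  simp only [expect, mix, Pi.add_apply, Pi.smul_apply, smul_eq_mul, Finset.mul_sum,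
    ← Finset.sum_add_distrib]
  exact Finset.sum_congr rfl fun j _ => by ring

theorem Truthful.mix {m n : ℕ} {a b : ℝ} {ha : 0 ≤ a} {hb : 0 ≤ b} {hab : a + b = 1}
    {J K : Mechanism m n} (hJ : Truthful J) (hK : Truthful K) :
    Truthful (mix a b ha hb hab J K) := by
  intro i u v
  rw [expect_mix, expect_mix]
  exact add_le_add (mul_le_mul_of_nonneg_left (hJ i u v) ha)
    (mul_le_mul_of_nonneg_left (hK i u v) hb)

theorem truthful_randomVoter {m n : ℕ} [NeZero n] {L : Valuation m → Lottery m}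
    (hL : ∀ u v : Valuation m, expect (L v) u ≤ expect (L u) u) : Truthful (randomVoter n L) := by
  intro i u v
  rw [expect_randomVoter, expect_randomVoter]
  refine div_le_div_of_nonneg_right (Finset.sum_le_sum fun k _ => ?_) (Nat.cast_nonneg n)
  by_cases hk : k = i
  · subst hk
    simpa using hL _ _
  · rw [Function.update_of_ne hk]

theorem perm_three_cases {P : Fin 3 → Fin 3 → Fin 3 → Prop} (h1 : P 0 1 2) (h2 : P 0 2 1)
    (h3 : P 1 0 2) (h4 : P 1 2 0) (h5 : P 2 0 1) (h6 : P 2 1 0) (ρ : Equiv.Perm (Fin 3)) :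
    P (ρ 0) (ρ 1) (ρ 2) := by
  have e1 : ρ 0 ≠ ρ 1 := ρ.injective.ne (by decide)
  have e2 : ρ 0 ≠ ρ 2 := ρ.injective.ne (by decide)
  have e3 : ρ 1 ≠ ρ 2 := ρ.injective.ne (by decide)
  generalize ρ 0 = x at *
  generalize ρ 1 = y at *
  generalize ρ 2 = z at *
  fin_cases x <;> fin_cases y <;> fin_cases z <;> first | assumption | simp at e1 e2 e3

/-- The expected value of `w` under the lottery that gives probability `p k` to the candidate
ranked `k` by `ρ`, after renaming candidates by `π`. -/
theorem sum_rank_mul (p w : Fin 3 → ℝ) (ρ π : Equiv.Perm (Fin 3)) :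
    ∑ j, p (ρ j) * w j = p (ρ (π 0)) * w (π 0) + p (ρ (π 1)) * w (π 1)
      + p (ρ (π 2)) * w (π 2) := by
  rw [← Equiv.sum_comp π, Fin.sum_univ_three]

theorem expect_favorite_le (u v : Valuation 3) :
    expect (favorite v) u ≤ expect (favorite u) u := by
  obtain ⟨ρ, a, ha, rfl⟩ := exists_ballot u
  obtain ⟨τ, b, hb, rfl⟩ := exists_ballot v
  have h0 := ha.1
  have h1 := ha.2
  have g0 := hb.1
  have g1 := hb.2
  simp only [expect, favorite_ballot, ballot_apply]
  rw [sum_rank_mul _ _ τ ρ.symm, sum_rank_mul _ _ ρ ρ.symm]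
  simp only [Equiv.apply_symm_apply]
  refine perm_three_cases (P := fun x y z => ![1, 0, 0] x * (![1, a, 0] : Fin 3 → ℝ) 0
    + ![1, 0, 0] y * (![1, a, 0] : Fin 3 → ℝ) 1 + ![1, 0, 0] z * (![1, a, 0] : Fin 3 → ℝ) 2 ≤ _)
    ?_ ?_ ?_ ?_ ?_ ?_ (ρ.symm.trans τ) <;> simp <;> linarith

/-- With the correct ranking, reporting b instead of a costs exactly (a - b)²/6. The three
probabilities decrease with the position, so by rearrangement a wrong ranking does no better. -/
theorem expect_quadratic_le (u v : Valuation 3) :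
    expect (quadratic v) u ≤ expect (quadratic u) u := by
  obtain ⟨ρ, a, ha, rfl⟩ := exists_ballot u
  obtain ⟨τ, b, hb, rfl⟩ := exists_ballot v
  have h0 := ha.1
  have h1 := ha.2
  have g0 := hb.1
  have g1 := hb.2
  simp only [expect, quadratic_ballot, ballot_apply]
  rw [sum_rank_mul _ _ τ ρ.symm, sum_rank_mul _ _ ρ ρ.symm]
  simp only [Equiv.apply_symm_apply]
  refine perm_three_cases (P := fun x y z =>
    (![(4 - b ^ 2) / 6, (1 + 2 * b) / 6, (1 - 2 * b + b ^ 2) / 6] : Fin 3 → ℝ) x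
      * (![1, a, 0] : Fin 3 → ℝ) 0
    + (![(4 - b ^ 2) / 6, (1 + 2 * b) / 6, (1 - 2 * b + b ^ 2) / 6] : Fin 3 → ℝ) y
      * (![1, a, 0] : Fin 3 → ℝ) 1
    + (![(4 - b ^ 2) / 6, (1 + 2 * b) / 6, (1 - 2 * b + b ^ 2) / 6] : Fin 3 → ℝ) z
      * (![1, a, 0] : Fin 3 → ℝ) 2 ≤ _)
    ?_ ?_ ?_ ?_ ?_ ?_ (ρ.symm.trans τ) <;> simp <;>
  nlinarith [sq_nonneg (a - b), mul_pos h0 g0, mul_pos (sub_pos.2 h1) (sub_pos.2 g1),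
    mul_pos h0 (sub_pos.2 g1), mul_pos g0 (sub_pos.2 h1), mul_pos g0 (sub_pos.2 g1),
    mul_pos h0 (sub_pos.2 h1), mul_pos h0 (mul_pos g0 (sub_pos.2 g1)), mul_pos h0 (mul_pos g0 g0)]

theorem truthful_mixedMechanism (n : ℕ) [NeZero n] : Truthful (mixedMechanism n) :=
  Truthful.mix (truthful_randomVoter expect_favorite_le) (truthful_randomVoter expect_quadratic_le)

/-! ### Generalities on welfare and the ratio -/

theorem exists_eq_one {m : ℕ} (u : Valuation m) : ∃ j, u j = 1 := u.2.2.2.2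

theorem welfare_nonneg {m n : ℕ} (u : Profile m n) (j : Fin m) : 0 ≤ welfare u j :=
  Finset.sum_nonneg fun i _ => ((u i).2.2.1 j).1

theorem welfare_le {m n : ℕ} (u : Profile m n) (j : Fin m) : welfare u j ≤ n := by
  refine (Finset.sum_le_sum fun i _ => ((u i).2.2.1 j).2).trans ?_
  simp

theorem welfare_le_iSup {m n : ℕ} (u : Profile m n) (j : Fin m) :
    welfare u j ≤ ⨆ j, welfare u j :=
  le_ciSup (Set.finite_range _).bddAbove j

theorem iSup_welfare_pos {m n : ℕ} [NeZero n] (u : Profile m n) : 0 < ⨆ j, welfare u j := by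
  have i : Fin n := ⟨0, NeZero.pos n⟩
  obtain ⟨j, hj⟩ := exists_eq_one (u i)
  refine lt_of_lt_of_le ?_ (welfare_le_iSup u j)
  refine lt_of_lt_of_le (b := u i j) (by rw [hj]; norm_num) ?_
  exact Finset.single_le_sum (f := fun i => u i j) (fun i _ => ((u i).2.2.1 j).1)
    (Finset.mem_univ i)

theorem expect_welfare_nonneg {m n : ℕ} (p : Lottery m) (u : Profile m n) :
    0 ≤ expect p (welfare u) :=
  Finset.sum_nonneg fun j _ => mul_nonneg (p.2.1 j) (welfare_nonneg u j)

instance : Nonempty (Valuation 3) := ⟨ballot 1 (1 / 2) ⟨by norm_num, by norm_num⟩⟩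

/-- A lower bound on the ratio may be checked with the candidates sorted by welfare. -/
theorem le_ratio {n : ℕ} [NeZero n] {J : Mechanism 3 n} {c : ℝ}
    (h : ∀ (u : Profile 3 n) (π : Equiv.Perm (Fin 3)), welfare u (π 1) ≤ welfare u (π 0) →
      welfare u (π 2) ≤ welfare u (π 1) → c * welfare u (π 0) ≤ expect (J u) (welfare u)) :
    c ≤ ratio J := by
  refine le_ciInf fun u => ?_
  rw [le_div_iff₀ (iSup_welfare_pos u)]
  let π := Tuple.sort (fun j => -welfare u j)
  have hm : Monotone ((fun j => -welfare u j) ∘ π) := Tuple.monotone_sort _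
  have h01 : welfare u (π 1) ≤ welfare u (π 0) := by
    simpa using hm (show (0 : Fin 3) ≤ 1 by decide)
  have h12 : welfare u (π 2) ≤ welfare u (π 1) := by
    simpa using hm (show (1 : Fin 3) ≤ 2 by decide)
  have hsup : ⨆ j, welfare u j = welfare u (π 0) := by
    refine le_antisymm (ciSup_le fun j => ?_) (welfare_le_iSup u _)
    simpa using hm (Fin.zero_le (π.symm j))
  rw [hsup]
  exact h u π h01 h12

/-- An upper bound on the ratio from one profile and one candidate. -/
theorem ratio_mul_welfare_le {m n : ℕ} [NeZero n] (J : Mechanism m n) (u : Profile m n)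
    (j : Fin m) : ratio J * welfare u j ≤ expect (J u) (welfare u) := by
  have h0 : ∀ v : Profile m n, 0 ≤ expect (J v) (welfare v) / ⨆ j, welfare v j := fun v =>
    div_nonneg (expect_welfare_nonneg _ _) (iSup_welfare_pos v).le
  have hle : ratio J ≤ expect (J u) (welfare u) / ⨆ j, welfare u j :=
    ciInf_le ⟨0, by rintro _ ⟨v, rfl⟩; exact h0 v⟩ u
  rw [le_div_iff₀ (iSup_welfare_pos u)] at hle
  exact (mul_le_mul_of_nonneg_left (welfare_le_iSup u j) (Real.iInf_nonneg h0)).trans hle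

/-! ### Lower bounds on the two ratios -/

theorem sum_welfare {n : ℕ} (u : Profile 3 n) (π : Equiv.Perm (Fin 3)) (x y z : ℝ) :
    ∑ i, (x * u i (π 0) + y * u i (π 1) + z * u i (π 2))
      = x * welfare u (π 0) + y * welfare u (π 1) + z * welfare u (π 2) := by
  simp only [welfare, Finset.sum_add_distrib, Finset.mul_sum]

theorem le_sum_welfare {n : ℕ} (u : Profile 3 n) (π : Equiv.Perm (Fin 3)) :
    (n : ℝ) ≤ welfare u (π 0) + welfare u (π 1) + welfare u (π 2) := by
  have h := sum_welfare u π 1 1 1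
  simp only [one_mul] at h
  rw [← h]
  have : ∀ i, (1 : ℝ) ≤ u i (π 0) + u i (π 1) + u i (π 2) := by
    intro i
    obtain ⟨j, hj⟩ := exists_eq_one (u i)
    have h3 : ∑ k, u i (π k) = ∑ k, u i k := Equiv.sum_comp π (fun k => u i k)
    rw [Fin.sum_univ_three] at h3
    rw [h3]
    exact hj.ge.trans (Finset.single_le_sum (f := fun k => u i k) (fun k _ => ((u i).2.2.1 k).1)
      (Finset.mem_univ j))
  simpa using Finset.sum_le_sum (s := Finset.univ) fun i _ => this i

/-- The weights are 645/1000 = 29/100 + 71/200 and 71/600. The exact error is α(29/100 w_mid +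
71/600 Σw) + 71/600 α(1 - α)(w_bot - w_top), with α = Σu - 1. Replacing w_mid by the largest value
absorbs the last term unless the worst candidate is ranked first. In that case α(1 - α) ≤ 1/4 yields
the term with 71/2400. -/
theorem mixed_voter_bound (u : Valuation 3) (w : Fin 3 → ℝ) (π : Equiv.Perm (Fin 3))
    (h01 : w (π 1) ≤ w (π 0)) (h12 : w (π 2) ≤ w (π 1)) :
    (645 / 1000 * w (π 0)) * u (π 0) + (645 / 1000 * w (π 1)) * u (π 1)
      + (645 / 1000 * w (π 2)) * u (π 2) + 71 / 600 * (w (π 0) + w (π 1) + w (π 2))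
      - (u (π 0) + u (π 1) + u (π 2) - 1)
        * (29 / 100 * w (π 0) + 71 / 600 * (w (π 0) + w (π 1) + w (π 2)))
      - 71 / 2400 * (w (π 1) - w (π 2)) * u (π 2)
    ≤ 29 / 100 * expect (favorite u) w + 71 / 100 * expect (quadratic u) w := by
  obtain ⟨ρ, a, h, rfl⟩ := exists_ballot u
  have h0 := h.1
  have h1 := h.2
  simp only [expect, favorite_ballot, quadratic_ballot, ballot_apply]
  rw [sum_rank_mul _ _ ρ π, sum_rank_mul _ _ ρ π]
  set x := w (π 0)
  set y := w (π 1)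
  set z := w (π 2)
  have e1 : 0 ≤ x - y := by linarith
  have e2 : 0 ≤ y - z := by linarith
  have f0 : 0 ≤ a * (1 - a) := by nlinarith
  have g1 := mul_nonneg h0.le e1
  have g2 := mul_nonneg h0.le e2
  have g3 := mul_nonneg f0 e1
  have g4 := mul_nonneg f0 e2
  have g5 : 0 ≤ (1 / 4 - a * (1 - a)) * (y - z) :=
    mul_nonneg (by nlinarith [sq_nonneg (a - 1 / 2)]) e2
  have g6 := mul_nonneg (mul_nonneg h0.le h0.le) e1
  have g7 := mul_nonneg (mul_nonneg h0.le h0.le) e2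
  refine perm_three_cases (P := fun r s t =>
    (645 / 1000 * x) * (![1, a, 0] : Fin 3 → ℝ) r + (645 / 1000 * y) * (![1, a, 0] : Fin 3 → ℝ) s
      + (645 / 1000 * z) * (![1, a, 0] : Fin 3 → ℝ) t + 71 / 600 * (x + y + z)
      - ((![1, a, 0] : Fin 3 → ℝ) r + (![1, a, 0] : Fin 3 → ℝ) s + (![1, a, 0] : Fin 3 → ℝ) t - 1)
        * (29 / 100 * x + 71 / 600 * (x + y + z))
      - 71 / 2400 * (y - z) * (![1, a, 0] : Fin 3 → ℝ) t
    ≤ 29 / 100 * (![1, 0, 0] r * x + ![1, 0, 0] s * y + ![1, 0, 0] t * z) + 71 / 100 *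
      ((![(4 - a ^ 2) / 6, (1 + 2 * a) / 6, (1 - 2 * a + a ^ 2) / 6] : Fin 3 → ℝ) r * x
      + (![(4 - a ^ 2) / 6, (1 + 2 * a) / 6, (1 - 2 * a + a ^ 2) / 6] : Fin 3 → ℝ) s * y
      + (![(4 - a ^ 2) / 6, (1 + 2 * a) / 6, (1 - 2 * a + a ^ 2) / 6] : Fin 3 → ℝ) t * z))
    ?_ ?_ ?_ ?_ ?_ ?_ (π.trans ρ) <;> simp <;> linarith

/-- The exact error is α/6 times α w_top + w_mid + (2 - α) w_bot. The weights α, 1, 2 - α are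
majorized by 2, 1, 0. -/
theorem quadratic_voter_bound (u : Valuation 3) (w : Fin 3 → ℝ) (π : Equiv.Perm (Fin 3))
    (h01 : w (π 1) ≤ w (π 0)) (h12 : w (π 2) ≤ w (π 1)) :
    (1 / 2 * w (π 0)) * u (π 0) + (1 / 2 * w (π 1)) * u (π 1)
      + (1 / 2 * w (π 2)) * u (π 2) + (w (π 0) + w (π 1) + w (π 2)) / 6
      - (u (π 0) + u (π 1) + u (π 2) - 1) * ((2 * w (π 0) + w (π 1)) / 6)
    ≤ expect (quadratic u) w := by
  obtain ⟨ρ, a, h, rfl⟩ := exists_ballot u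
  have h0 := h.1
  have h1 := h.2
  simp only [expect, quadratic_ballot, ballot_apply]
  rw [sum_rank_mul _ _ ρ π]
  set x := w (π 0)
  set y := w (π 1)
  set z := w (π 2)
  have e1 : 0 ≤ x - y := by linarith
  have e2 : 0 ≤ y - z := by linarith
  have f0 : 0 ≤ a * (1 - a) := by nlinarith
  have g1 := mul_nonneg h0.le e1
  have g2 := mul_nonneg h0.le e2
  have g3 := mul_nonneg f0 e1
  have g4 := mul_nonneg f0 e2
  have g6 := mul_nonneg (mul_nonneg h0.le h0.le) e1
  have g7 := mul_nonneg (mul_nonneg h0.le h0.le) e2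
  refine perm_three_cases (P := fun r s t =>
    (1 / 2 * x) * (![1, a, 0] : Fin 3 → ℝ) r + (1 / 2 * y) * (![1, a, 0] : Fin 3 → ℝ) s
      + (1 / 2 * z) * (![1, a, 0] : Fin 3 → ℝ) t + (x + y + z) / 6
      - ((![1, a, 0] : Fin 3 → ℝ) r + (![1, a, 0] : Fin 3 → ℝ) s + (![1, a, 0] : Fin 3 → ℝ) t - 1)
        * ((2 * x + y) / 6)
    ≤ (![(4 - a ^ 2) / 6, (1 + 2 * a) / 6, (1 - 2 * a + a ^ 2) / 6] : Fin 3 → ℝ) r * x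
      + (![(4 - a ^ 2) / 6, (1 + 2 * a) / 6, (1 - 2 * a + a ^ 2) / 6] : Fin 3 → ℝ) s * y
      + (![(4 - a ^ 2) / 6, (1 + 2 * a) / 6, (1 - 2 * a + a ^ 2) / 6] : Fin 3 → ℝ) t * z)
    ?_ ?_ ?_ ?_ ?_ ?_ (π.trans ρ) <;> simp <;> linarith

theorem mixed_welfare_bound {a b c : ℝ} (ha : a ≤ 1) (hs : 1 ≤ a + b + c) :
    6601 / 10000 * a ≤ 645 / 1000 * (a ^ 2 + b ^ 2 + c ^ 2) + 71 / 600 * (a + b + c)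
      - (a + b + c - 1) * (29 / 100 * a + 71 / 600 * (a + b + c)) - 71 / 2400 * (b - c) * c := by
  obtain ⟨t, ht⟩ : ∃ t, t = a + b + c - 1 := ⟨_, rfl⟩
  obtain ⟨d, hd⟩ : ∃ d, d = b - c := ⟨_, rfl⟩
  have hb : b = (1 + t - a + d) / 2 := by linarith
  have hc : c = (1 + t - a - d) / 2 := by linarith
  have ht0 : 0 ≤ t := by linarith
  subst hb hc
  clear hs ht hd
  -- What remains, up to rounding, after minimizing over d; the minimum is near d = 0.0219(1 + t -
  -- a). The coefficient of t changes sign near a = 0.6897, whence the case split.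
  have hq : 0 ≤ 203996 / 1000000 * t ^ 2 + (64466 / 100000 - 93466 / 100000 * a) * t
      + (96733 / 100000 * a ^ 2 - 130476 / 100000 * a + 44066 / 100000) := by
    rcases le_total a (69 / 100) with h | h
    · rcases le_total a (6897 / 10000) with h' | h'
      · nlinarith [mul_nonneg ht0 (sub_nonneg.2 h'), sq_nonneg (a - 65238 / 96733), sq_nonneg t]
      · nlinarith [mul_nonneg ht0 (sub_nonneg.2 h), sq_nonneg (a - 65238 / 96733), sq_nonneg t,
          mul_nonneg (sub_nonneg.2 h) (sub_nonneg.2 h')]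
    · nlinarith [sq_nonneg (t + (64466 / 100000 - 93466 / 100000 * a) / (407992 / 1000000)),
        mul_nonneg (sub_nonneg.2 h) (sub_nonneg.2 ha)]
  nlinarith [sq_nonneg (d - 219 / 10000 * (1 + t - a)),
    sq_nonneg (1 + t - a), sq_nonneg d, hq]

/-- The minimum over d = b - c is at d = t/6. At t = 0 the difference of the two sides is then 3/4
(a - √5/3)², which is where the golden ratio comes from. -/
theorem quadratic_welfare_bound {a b c : ℝ} (ha : a ≤ 1) (hs : 1 ≤ a + b + c) :
    (√5 - 1) / 2 * a ≤ 1 / 2 * (a ^ 2 + b ^ 2 + c ^ 2) + (a + b + c) / 6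
      - (a + b + c - 1) * ((2 * a + b) / 6) := by
  obtain ⟨t, ht⟩ : ∃ t, t = a + b + c - 1 := ⟨_, rfl⟩
  obtain ⟨d, hd⟩ : ∃ d, d = b - c := ⟨_, rfl⟩
  have hb : b = (1 + t - a + d) / 2 := by linarith
  have hc : c = (1 + t - a - d) / 2 := by linarith
  have ht0 : 0 ≤ t := by linarith
  subst hb hc
  clear hs ht hd
  have h5 : √5 ^ 2 = 5 := Real.sq_sqrt (by norm_num)
  have h5u : √5 ≤ 2237 / 1000 := by
    rw [Real.sqrt_le_left (by norm_num)]; norm_num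
  have h50 := Real.sqrt_nonneg 5
  have hq : 0 ≤ 3 / 4 * (a - √5 / 3) ^ 2 + t * (7 / 12 - 3 / 4 * a) + 23 / 144 * t ^ 2 := by
    rcases le_total a (7 / 9) with h | h
    · have := mul_nonneg ht0 (show 0 ≤ 7 / 12 - 3 / 4 * a by linarith)
      positivity
    · have h1 : 0 ≤ 3 / 4 * a - 7 / 12 := by linarith
      -- Nonpositive discriminant in t. The constant 69/100 below is just under √(69/144), and the
      -- linear comparison is tightest at a = 1.
      have h2 : (3 / 4 * a - 7 / 12) ^ 2 ≤ 4 * (23 / 144) * (3 / 4 * (a - √5 / 3) ^ 2) := by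
        have h3 : (3 / 4 * a - 7 / 12) ≤ 69 / 100 * (a - √5 / 3) := by linarith
        have := pow_le_pow_left₀ h1 h3 2
        nlinarith [sq_nonneg (a - √5 / 3)]
      nlinarith [sq_nonneg (23 / 72 * t - (3 / 4 * a - 7 / 12))]
  nlinarith [sq_nonneg (d - t / 6), hq]

theorem lt_ratio_mixedMechanism (n : ℕ) [NeZero n] : 33 / 50 < ratio (mixedMechanism n) := by
  refine lt_of_lt_of_le (b := 6601 / 10000) (by norm_num) (le_ratio fun u π h01 h12 => ?_)
  have hn : (0 : ℝ) < n := Nat.cast_pos.2 (NeZero.pos n)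
  have hsum := Finset.sum_le_sum (s := Finset.univ) fun i _ =>
    mixed_voter_bound (u i) (welfare u) π h01 h12
  have hexp : expect (mixedMechanism n u) (welfare u) = (∑ i, (29 / 100 *
      expect (favorite (u i)) (welfare u) + 71 / 100 * expect (quadratic (u i)) (welfare u))) / n := by
    rw [mixedMechanism, expect_mix, randomFavorite, quadraticLottery, expect_randomVoter,
      expect_randomVoter, Finset.sum_add_distrib, ← Finset.mul_sum, ← Finset.mul_sum]
    ring
  rw [hexp, le_div_iff₀ hn]
  refine le_trans ?_ hsum
  have hW := welfare_le u (π 0)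
  have hS := le_sum_welfare u π
  set x := welfare u (π 0)
  set y := welfare u (π 1)
  set z := welfare u (π 2)
  set k := 29 / 100 * x + 71 / 600 * (x + y + z) with hk
  have key := mixed_welfare_bound (a := x / n) (b := y / n) (c := z / n)
    ((div_le_one hn).2 hW) (by rw [← add_div, ← add_div, le_div_iff₀ hn]; linarith)
  have hsplit : ∀ i, (645 / 1000 * x) * u i (π 0) + (645 / 1000 * y) * u i (π 1)
      + (645 / 1000 * z) * u i (π 2) + 71 / 600 * (x + y + z)
      - (u i (π 0) + u i (π 1) + u i (π 2) - 1) * k - 71 / 2400 * (y - z) * u i (π 2)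
      = ((645 / 1000 * x - k) * u i (π 0) + (645 / 1000 * y - k) * u i (π 1)
      + (645 / 1000 * z - k - 71 / 2400 * (y - z)) * u i (π 2))
        + (71 / 600 * (x + y + z) + k) := fun i => by ring
  rw [Finset.sum_congr rfl fun i _ => hsplit i, Finset.sum_add_distrib, sum_welfare]
  simp only [Finset.sum_const, Finset.card_univ, Fintype.card_fin, nsmul_eq_mul]
  have key' := mul_le_mul_of_nonneg_left key (sq_nonneg (n : ℝ))
  field_simp at key'
  rw [hk]
  change 6601 / 10000 * x * n ≤ (645 / 1000 * x - _) * x + (645 / 1000 * y - _) * y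
    + (645 / 1000 * z - _ - _) * z + _
  linarith

theorem le_ratio_quadraticLottery (n : ℕ) [NeZero n] :
    (√5 - 1) / 2 ≤ ratio (quadraticLottery n) := by
  refine le_ratio fun u π h01 h12 => ?_
  have hn : (0 : ℝ) < n := Nat.cast_pos.2 (NeZero.pos n)
  have hsum := Finset.sum_le_sum (s := Finset.univ) fun i _ =>
    quadratic_voter_bound (u i) (welfare u) π h01 h12
  rw [quadraticLottery, expect_randomVoter, le_div_iff₀ hn]
  refine le_trans ?_ hsum
  have hW := welfare_le u (π 0)
  have hS := le_sum_welfare u π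
  set x := welfare u (π 0)
  set y := welfare u (π 1)
  set z := welfare u (π 2)
  set k := (2 * x + y) / 6 with hk
  have key := quadratic_welfare_bound (a := x / n) (b := y / n) (c := z / n)
    ((div_le_one hn).2 hW) (by rw [← add_div, ← add_div, le_div_iff₀ hn]; linarith)
  have hsplit : ∀ i, (1 / 2 * x) * u i (π 0) + (1 / 2 * y) * u i (π 1)
      + (1 / 2 * z) * u i (π 2) + (x + y + z) / 6
      - (u i (π 0) + u i (π 1) + u i (π 2) - 1) * k
      = ((1 / 2 * x - k) * u i (π 0) + (1 / 2 * y - k) * u i (π 1)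
      + (1 / 2 * z - k) * u i (π 2)) + ((x + y + z) / 6 + k) := fun i => by ring
  rw [Finset.sum_congr rfl fun i _ => hsplit i, Finset.sum_add_distrib, sum_welfare]
  simp only [Finset.sum_const, Finset.card_univ, Fintype.card_fin, nsmul_eq_mul]
  have key' := mul_le_mul_of_nonneg_left key (sq_nonneg (n : ℝ))
  field_simp at key'
  rw [hk]
  change (√5 - 1) / 2 * x * n ≤ (1 / 2 * x - _) * x + (1 / 2 * y - _) * y
    + (1 / 2 * z - _) * z + _
  linarith

/-! ### Near-extremal profiles and the limit for the quadratic lottery -/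

/-- The block of index `i` when the first `k` indices form block `0`, the next `h` block `1`, and
the others block `2`. -/
def block {n : ℕ} (k h : ℕ) (i : Fin n) : Fin 3 :=
  if (i : ℕ) < k then 0 else if (i : ℕ) < k + h then 1 else 2

theorem sum_block {n k h l : ℕ} (hn : n = k + h + l) (f : Fin 3 → ℝ) :
    ∑ i : Fin n, f (block k h i) = k * f 0 + h * f 1 + l * f 2 := by
  subst hn
  rw [Fin.sum_univ_add, Fin.sum_univ_add]
  have h0 : ∀ i : Fin k, block k h (Fin.castAdd l (Fin.castAdd h i)) = 0 := fun i => by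
    simp [block]
  have h1 : ∀ i : Fin h, block k h (Fin.castAdd l (Fin.natAdd k i)) = 1 := fun i => by
    simp [block]
  have h2 : ∀ i : Fin l, block k h (Fin.natAdd (k + h) i) = 2 := fun i => by
    simp [block, add_assoc]
  simp [h0, h1, h2]

/-- Evaluated at a profile where blocks of sizes k, h, l have favorites 0, 1, 2 and all second
values are ε. -/
theorem ratio_quadraticLottery_le {n k h l : ℕ} [NeZero n] (hn : n = k + h + l) {ε : ℝ}
    (hε : ε ∈ Set.Ioo (0 : ℝ) 1) :
    ratio (quadraticLottery n) * (k + h * ε + l * ε) * n ≤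
      k * ((4 - ε ^ 2) / 6 * (k + h * ε + l * ε) + (1 + 2 * ε) / 6 * (k * ε + h)
          + (1 - 2 * ε + ε ^ 2) / 6 * l)
      + h * ((1 + 2 * ε) / 6 * (k + h * ε + l * ε) + (4 - ε ^ 2) / 6 * (k * ε + h)
          + (1 - 2 * ε + ε ^ 2) / 6 * l)
      + l * ((1 + 2 * ε) / 6 * (k + h * ε + l * ε) + (1 - 2 * ε + ε ^ 2) / 6 * (k * ε + h)
          + (4 - ε ^ 2) / 6 * l) := by
  have hn0 : (0 : ℝ) < n := Nat.cast_pos.2 (NeZero.pos n)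
  let θ : Fin 3 → Equiv.Perm (Fin 3) := ![1, Equiv.swap 0 1, finRotate 3]
  let u : Profile 3 n := fun i => ballot (θ (block k h i)) ε hε
  have hw : ∀ j, welfare u j = k * ![1, ε, 0] (θ 0 j) + h * ![1, ε, 0] (θ 1 j)
      + l * ![1, ε, 0] (θ 2 j) := fun j =>
    sum_block hn fun t => (![1, ε, 0] : Fin 3 → ℝ) (θ t j)
  have hr1 : Equiv.swap (0 : Fin 3) 1 2 = 2 := by decide
  have hr2 : finRotate 3 0 = 1 := by decide
  have hr3 : finRotate 3 1 = 2 := by decide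
  have hr4 : finRotate 3 2 = 0 := by decide
  have hw0 : welfare u 0 = k + h * ε + l * ε := by
    rw [hw]; simp [θ, hr2]
  have hw1 : welfare u 1 = k * ε + h := by
    rw [hw]; simp [θ, hr3]
  have hw2 : welfare u 2 = l := by
    rw [hw]; simp [θ, hr1, hr4]
  have key := ratio_mul_welfare_le (quadraticLottery n) u 0
  rw [quadraticLottery, expect_randomVoter, le_div_iff₀ hn0] at key
  simp only [u, expect, quadratic_ballot] at key
  rw [sum_block hn fun t => ∑ j, (![(4 - ε ^ 2) / 6, (1 + 2 * ε) / 6, (1 - 2 * ε + ε ^ 2) / 6]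
    : Fin 3 → ℝ) (θ t j) * welfare u j] at key
  simp only [Fin.sum_univ_three, hw0, hw1, hw2] at key
  simpa [θ, hr1, hr2, hr3, hr4, quadraticLottery, hw0, u] using key

theorem tendsto_floor_succ {x : ℝ} (hx : 0 ≤ x) :
    Tendsto (fun N : ℕ => (⌊x * ((N + 1 : ℕ) : ℝ)⌋₊ : ℝ) / ((N + 1 : ℕ) : ℝ)) atTop (𝓝 x) :=
  (tendsto_nat_floor_mul_div_atTop hx).comp
    (tendsto_natCast_atTop_atTop.comp (tendsto_add_atTop_nat 1))

theorem tendsto_ratio_quadraticLottery :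
    Tendsto (fun k : ℕ => ratio (quadraticLottery (k + 1))) atTop (𝓝 ((√5 - 1) / 2)) := by
  have h5 : √5 ^ 2 = 5 := Real.sq_sqrt (by norm_num)
  have h5u : √5 < 3 := by
    rw [Real.sqrt_lt' (by norm_num)]; norm_num
  have h50 : 0 < √5 := Real.sqrt_pos.2 (by norm_num)
  -- The equality case of `quadratic_welfare_bound`: a fraction √5/3 favors candidate 0, and the
  -- rest is split evenly.
  obtain ⟨ξ, hξ⟩ : ∃ ξ, ξ = √5 / 3 := ⟨_, rfl⟩
  have hξ0 : 0 < ξ := by rw [hξ]; positivity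
  have hξ1 : ξ < 1 := by rw [hξ]; linarith
  let X : ℕ → ℝ := fun N => (⌊ξ * ((N + 1 : ℕ) : ℝ)⌋₊ : ℝ) / ((N + 1 : ℕ) : ℝ)
  let Y : ℕ → ℝ := fun N => (⌊(1 - ξ) / 2 * ((N + 1 : ℕ) : ℝ)⌋₊ : ℝ) / ((N + 1 : ℕ) : ℝ)
  let Z : ℕ → ℝ := fun N => 1 - X N - Y N
  let E : ℕ → ℝ := fun N => 1 / (((N + 1 : ℕ) : ℝ) + 1)
  have hX : Tendsto X atTop (𝓝 ξ) := tendsto_floor_succ hξ0.le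
  have hY : Tendsto Y atTop (𝓝 ((1 - ξ) / 2)) := tendsto_floor_succ (by linarith)
  have hZ : Tendsto Z atTop (𝓝 (1 - ξ - (1 - ξ) / 2)) := (tendsto_const_nhds.sub hX).sub hY
  have hE : Tendsto E atTop (𝓝 0) :=
    tendsto_one_div_add_atTop_nhds_zero_nat.comp (tendsto_add_atTop_nat 1)
  let Φ : ℝ × ℝ × ℝ × ℝ → ℝ := fun p =>
    (p.1 * ((4 - p.2.2.2 ^ 2) / 6 * (p.1 + p.2.1 * p.2.2.2 + p.2.2.1 * p.2.2.2)
        + (1 + 2 * p.2.2.2) / 6 * (p.1 * p.2.2.2 + p.2.1)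
        + (1 - 2 * p.2.2.2 + p.2.2.2 ^ 2) / 6 * p.2.2.1)
      + p.2.1 * ((1 + 2 * p.2.2.2) / 6 * (p.1 + p.2.1 * p.2.2.2 + p.2.2.1 * p.2.2.2)
        + (4 - p.2.2.2 ^ 2) / 6 * (p.1 * p.2.2.2 + p.2.1)
        + (1 - 2 * p.2.2.2 + p.2.2.2 ^ 2) / 6 * p.2.2.1)
      + p.2.2.1 * ((1 + 2 * p.2.2.2) / 6 * (p.1 + p.2.1 * p.2.2.2 + p.2.2.1 * p.2.2.2)
        + (1 - 2 * p.2.2.2 + p.2.2.2 ^ 2) / 6 * (p.1 * p.2.2.2 + p.2.1)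
        + (4 - p.2.2.2 ^ 2) / 6 * p.2.2.1))
      / (p.1 + p.2.1 * p.2.2.2 + p.2.2.1 * p.2.2.2)
  have hΦ : ContinuousAt Φ (ξ, (1 - ξ) / 2, 1 - ξ - (1 - ξ) / 2, 0) := by
    refine ContinuousAt.div (by fun_prop) (by fun_prop) ?_
    simpa using hξ0.ne'
  have hval : Φ (ξ, (1 - ξ) / 2, 1 - ξ - (1 - ξ) / 2, 0) = (√5 - 1) / 2 := by
    simp only [Φ]
    rw [div_eq_iff (by simpa using hξ0.ne'), hξ]
    nlinarith
  have hlim : Tendsto (fun N => Φ (X N, Y N, Z N, E N)) atTop (𝓝 ((√5 - 1) / 2)) := by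
    rw [← hval]
    exact hΦ.tendsto.comp
      (hX.prodMk_nhds (hY.prodMk_nhds (hZ.prodMk_nhds hE)))
  refine tendsto_of_tendsto_of_tendsto_of_le_of_le' tendsto_const_nhds hlim
    (Eventually.of_forall fun N => le_ratio_quadraticLottery _) ?_
  filter_upwards [hX.eventually (lt_mem_nhds hξ0)] with N hXN
  have hn : (0 : ℝ) < ((N + 1 : ℕ) : ℝ) := by positivity
  have hk : (⌊ξ * ((N + 1 : ℕ) : ℝ)⌋₊ : ℝ) ≤ ξ * ((N + 1 : ℕ) : ℝ) := Nat.floor_le (by positivity)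
  have hh : (⌊(1 - ξ) / 2 * ((N + 1 : ℕ) : ℝ)⌋₊ : ℝ) ≤ (1 - ξ) / 2 * ((N + 1 : ℕ) : ℝ) :=
    Nat.floor_le (mul_nonneg (by linarith) hn.le)
  have hle : ⌊ξ * ((N + 1 : ℕ) : ℝ)⌋₊ + ⌊(1 - ξ) / 2 * ((N + 1 : ℕ) : ℝ)⌋₊ ≤ N + 1 := by
    have : ((⌊ξ * ((N + 1 : ℕ) : ℝ)⌋₊ + ⌊(1 - ξ) / 2 * ((N + 1 : ℕ) : ℝ)⌋₊ : ℕ) : ℝ)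
        ≤ ((N + 1 : ℕ) : ℝ) := by
      push_cast at hk hh hn ⊢
      nlinarith
    exact_mod_cast this
  obtain ⟨l, hl⟩ := Nat.exists_eq_add_of_le hle
  have hEpos : 0 < E N := by positivity
  have hE1 : E N < 1 := by
    simp only [E]
    rw [div_lt_one (by positivity)]
    linarith
  have key := ratio_quadraticLottery_le hl ⟨hEpos, hE1⟩
  have ek : (⌊ξ * ((N + 1 : ℕ) : ℝ)⌋₊ : ℝ) = X N * ((N + 1 : ℕ) : ℝ) := by
    simp only [X]; field_simp
  have eh : (⌊(1 - ξ) / 2 * ((N + 1 : ℕ) : ℝ)⌋₊ : ℝ) = Y N * ((N + 1 : ℕ) : ℝ) := by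
    simp only [Y]; field_simp
  have el : (l : ℝ) = Z N * ((N + 1 : ℕ) : ℝ) := by
    have : ((N + 1 : ℕ) : ℝ) = (⌊ξ * ((N + 1 : ℕ) : ℝ)⌋₊ : ℝ)
        + (⌊(1 - ξ) / 2 * ((N + 1 : ℕ) : ℝ)⌋₊ : ℝ) + (l : ℝ) := by exact_mod_cast hl
    rw [ek, eh] at this
    simp only [Z]
    linarith
  have hY0 : 0 ≤ Y N := by positivity
  have hZ0 : 0 ≤ Z N := by
    by_contra hneg
    have : (l : ℝ) < 0 := by rw [el]; exact mul_neg_of_neg_of_pos (not_le.1 hneg) hn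
    exact absurd (Nat.cast_nonneg l) (not_le.2 this)
  rw [ek, eh, el] at key
  change _ ≤ _ / _
  rw [le_div_iff₀ (by positivity)]
  -- The bound is homogeneous of degree 2 in the block sizes, so this factor restores the
  -- unnormalized inequality.
  refine le_of_mul_le_mul_right (a := ((N + 1 : ℕ) : ℝ) ^ 2) ?_ (by positivity)
  generalize ((N + 1 : ℕ) : ℝ) = c at key ⊢
  nlinarith [key]

/-! ### Localization of truthful ordinal mechanisms -/

/-- A function of a profile that is invariant under related changes of a single entry is invariant
under related changes of all entries. -/
theorem eq_of_forall_update {n : ℕ} {α β : Type*} {r : α → α → Prop} {F : (Fin n → α) → β}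
    (h : ∀ (i : Fin n) (R : Fin n → α) (b : α), r (R i) b → F (Function.update R i b) = F R)
    {R R' : Fin n → α} (hR : ∀ i, r (R i) (R' i)) : F R' = F R := by
  classical
  have key : ∀ s : Finset (Fin n), F (s.piecewise R' R) = F R := by
    intro s
    induction s using Finset.induction_on with
    | empty => simp
    | insert i s hi ih =>
      rw [Finset.piecewise_insert, h, ih]
      rw [Finset.piecewise_eq_of_notMem _ _ _ hi]
      exact hR i
  simpa using key Finset.univ

/-- The same candidates are ranked above `x`. -/
def SameAbove (x : Fin 3) (ρ τ : Equiv.Perm (Fin 3)) : Prop := ∀ y, ρ y < ρ x ↔ τ y < τ x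

instance (x : Fin 3) (ρ τ : Equiv.Perm (Fin 3)) : Decidable (SameAbove x ρ τ) :=
  inferInstanceAs (Decidable (∀ y, ρ y < ρ x ↔ τ y < τ x))

theorem SameAbove.cases {x : Fin 3} {ρ τ : Equiv.Perm (Fin 3)} (h : SameAbove x ρ τ) :
    ρ = τ ∨ (x = ρ.symm 0 ∧ x = τ.symm 0) ∨ (x = ρ.symm 2 ∧ x = τ.symm 2) := by
  revert x ρ τ
  decide

theorem SameAbove.mul_right {x : Fin 3} {ρ τ : Equiv.Perm (Fin 3)} (σ : Equiv.Perm (Fin 3))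
    (h : SameAbove (σ x) ρ τ) : SameAbove x (ρ * σ) (τ * σ) := fun y => h (σ y)

theorem half_mem_Ioo : (1 / 2 : ℝ) ∈ Set.Ioo (0 : ℝ) 1 := by norm_num

/-- The lottery of the ordinal mechanism `J` at a profile of rankings. -/
def rankProb {n : ℕ} (J : Mechanism 3 n) (R : Fin n → Equiv.Perm (Fin 3)) : Fin 3 → ℝ :=
  (J fun i => ballot (R i) (1 / 2) half_mem_Ioo).1

theorem Ordinal.eq_rankProb {n : ℕ} {J : Mechanism 3 n} (hJ : Ordinal J)
    (R : Fin n → Equiv.Perm (Fin 3)) (u : Profile 3 n)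
    (hu : ∀ i j k, u i j < u i k ↔ R i k < R i j) : (J u).1 = rankProb J R := by
  rw [rankProb]
  congr 1
  refine (eq_of_forall_update (r := fun u v : Valuation 3 => ∀ j k, u j < u k ↔ v j < v k)
    (F := J) (fun i u v h => hJ i u v h) fun i j k => ?_).symm
  rw [hu, ballot_lt_iff]

theorem nonpos_of_forall_Ioo {p q : ℝ} (h : ∀ a ∈ Set.Ioo (0 : ℝ) 1, p + a * q ≤ 0) : p ≤ 0 := by
  by_contra hp
  push Not at hp
  have h2 := h (1 / 2) ⟨by norm_num, by norm_num⟩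
  have hq : q < 0 := by linarith
  -- At this value of a the expression equals p/2 > 0.
  have h3 := h (p / (-2 * q)) ⟨div_pos hp (by linarith), by
    rw [div_lt_one (by linarith)]; linarith⟩
  have : p / (-2 * q) * q = -p / 2 := by
    have := hq.ne
    field_simp
  linarith

theorem nonpos_of_forall_Ioo' {p q : ℝ} (h : ∀ a ∈ Set.Ioo (0 : ℝ) 1, p + a * q ≤ 0) :
    p + q ≤ 0 :=
  nonpos_of_forall_Ioo (q := -q) fun a ha => by
    have := h (1 - a) ⟨by linarith [ha.2], by linarith [ha.1]⟩
    linarith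

theorem sum_ballot (p : Fin 3 → ℝ) (ρ : Equiv.Perm (Fin 3)) (a : ℝ) :
    ∑ j, p j * ![1, a, 0] (ρ j) = p (ρ.symm 0) + a * p (ρ.symm 1) := by
  rw [← Equiv.sum_comp ρ.symm, Fin.sum_univ_three]
  simp [mul_comm]

theorem sum_symm (p : Fin 3 → ℝ) (ρ : Equiv.Perm (Fin 3)) :
    p (ρ.symm 0) + p (ρ.symm 1) + p (ρ.symm 2) = ∑ j, p j := by
  rw [← Equiv.sum_comp ρ.symm, Fin.sum_univ_three]

/-- Ordinality makes the lottery independent of the second value, so a single pair of lotteries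
satisfies the truthfulness inequality for every a. -/
theorem Truthful.rankProb_update_le {n : ℕ} {J : Mechanism 3 n} (hT : Truthful J)
    (hJ : Ordinal J) (R : Fin n → Equiv.Perm (Fin 3)) (i : Fin n) (τ : Equiv.Perm (Fin 3))
    {a : ℝ} (ha : a ∈ Set.Ioo (0 : ℝ) 1) :
    rankProb J (Function.update R i τ) ((R i).symm 0)
        + a * rankProb J (Function.update R i τ) ((R i).symm 1)
      ≤ rankProb J R ((R i).symm 0) + a * rankProb J R ((R i).symm 1) := by
  have key := hT i (fun k => ballot (R k) a ha) (ballot τ (1 / 2) half_mem_Ioo)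
  simp only [expect, ballot_apply] at key
  rw [sum_ballot, sum_ballot, hJ.eq_rankProb R _ fun k j l => ballot_lt_iff _ _ _ _ _,
    hJ.eq_rankProb (Function.update R i τ)] at key
  · exact key
  · intro k j l
    by_cases hk : k = i
    · subst hk
      simp only [Function.update_self]
      exact ballot_lt_iff _ _ _ _ _
    · simp only [Function.update_of_ne hk]
      exact ballot_lt_iff _ _ _ _ _

/-- Lotteries indexed by rankings in which the probability of a candidate depends, for each voter,
only on the set of candidates ranked above it. -/
structure Localized {n : ℕ} (P : (Fin n → Equiv.Perm (Fin 3)) → Fin 3 → ℝ) : Prop where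
  nonneg : ∀ R x, 0 ≤ P R x
  sum_eq : ∀ R, P R 0 + P R 1 + P R 2 = 1
  congr : ∀ {R R'} {x}, (∀ i, SameAbove x (R i) (R' i)) → P R' x = P R x

/-- Two distinct rankings with the same candidates above x both have x first or both have x last.
Truthfulness in both directions fixes the probability of a common first candidate as a → 0, and of a
common last one as a → 1. -/
theorem Truthful.localized {n : ℕ} {J : Mechanism 3 n} (hT : Truthful J) (hJ : Ordinal J) :
    Localized (rankProb J) := by
  have hsum : ∀ R : Fin n → Equiv.Perm (Fin 3), ∑ j, rankProb J R j = 1 := fun R => (J _).2.2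
  refine ⟨fun R x => (J _).2.1 x, fun R => ?_, fun {R R' x} h => ?_⟩
  · rw [← Fin.sum_univ_three, hsum]
  refine eq_of_forall_update (F := fun R => rankProb J R x) (fun i R τ h => ?_) h
  have h1 := fun a ha => hT.rankProb_update_le hJ R i τ (a := a) ha
  have h2 := fun a ha => hT.rankProb_update_le hJ (Function.update R i τ) i (R i) (a := a) ha
  simp only [Function.update_self, Function.update_idem, Function.update_eq_self] at h2
  rcases h.cases with h | ⟨e1, e2⟩ | ⟨e1, e2⟩
  · rw [← h, Function.update_eq_self]
  · have a1 := nonpos_of_forall_Ioo (p := rankProb J (Function.update R i τ) ((R i).symm 0)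
      - rankProb J R ((R i).symm 0)) (q := rankProb J (Function.update R i τ) ((R i).symm 1)
      - rankProb J R ((R i).symm 1)) fun a ha => by linarith [h1 a ha]
    have a2 := nonpos_of_forall_Ioo (p := rankProb J R (τ.symm 0)
      - rankProb J (Function.update R i τ) (τ.symm 0)) (q := rankProb J R (τ.symm 1)
      - rankProb J (Function.update R i τ) (τ.symm 1)) fun a ha => by linarith [h2 a ha]
    rw [← e1] at a1
    rw [← e2] at a2
    linarith
  · have a1 := nonpos_of_forall_Ioo' (p := rankProb J (Function.update R i τ) ((R i).symm 0)
      - rankProb J R ((R i).symm 0)) (q := rankProb J (Function.update R i τ) ((R i).symm 1)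
      - rankProb J R ((R i).symm 1)) fun a ha => by linarith [h1 a ha]
    have a2 := nonpos_of_forall_Ioo' (p := rankProb J R (τ.symm 0)
      - rankProb J (Function.update R i τ) (τ.symm 0)) (q := rankProb J R (τ.symm 1)
      - rankProb J (Function.update R i τ) (τ.symm 1)) fun a ha => by linarith [h2 a ha]
    have s1 := sum_symm (rankProb J R) (R i)
    have s2 := sum_symm (rankProb J (Function.update R i τ)) (R i)
    have s3 := sum_symm (rankProb J R) τ
    have s4 := sum_symm (rankProb J (Function.update R i τ)) τ
    rw [hsum, ← e1] at s1 s2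
    rw [hsum, ← e2] at s3 s4
    linarith

/-! ### Invariance of the averaged middle probability -/

/-- Renaming the candidates cyclically. -/
def rotate {n : ℕ} (P : (Fin n → Equiv.Perm (Fin 3)) → Fin 3 → ℝ)
    (R : Fin n → Equiv.Perm (Fin 3)) (x : Fin 3) : ℝ :=
  P (fun i => R i * (finRotate 3)⁻¹) (finRotate 3 x)

theorem rotate_rotate_rotate {n : ℕ} (P : (Fin n → Equiv.Perm (Fin 3)) → Fin 3 → ℝ) :
    rotate (rotate (rotate P)) = P := by
  have h1 : (finRotate 3)⁻¹ * (finRotate 3)⁻¹ * (finRotate 3)⁻¹ = 1 := by decide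
  have h2 : ∀ x, finRotate 3 (finRotate 3 (finRotate 3 x)) = x := by decide
  funext R x
  simp only [rotate, h2, mul_assoc] at h1 ⊢
  simp only [h1, mul_one]

theorem Localized.rotate {n : ℕ} {P : (Fin n → Equiv.Perm (Fin 3)) → Fin 3 → ℝ}
    (hP : Localized P) : Localized (rotate P) := by
  have hr2 : finRotate 3 0 = 1 := by decide
  have hr3 : finRotate 3 1 = 2 := by decide
  have hr4 : finRotate 3 2 = 0 := by decide
  refine ⟨fun R x => hP.nonneg _ _, fun R => ?_, fun {R R' x} h => ?_⟩
  · have := hP.sum_eq fun i => R i * (finRotate 3)⁻¹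
    simp only [Voting.rotate, hr2, hr3, hr4]
    linarith
  · refine hP.congr fun i => SameAbove.mul_right _ ?_
    simpa using h i

/-- Voters in `s` have ranking `ρ`, the others `τ`. -/
def twoRankings {n : ℕ} (s : Finset (Fin n)) (ρ τ : Equiv.Perm (Fin 3)) :
    Fin n → Equiv.Perm (Fin 3) := fun i => if i ∈ s then ρ else τ

/-- The probability of candidate `1` when `s` ranks `0, 1, 2` and the others rank `2, 1, 0`. -/
def middleProb {n : ℕ} (P : (Fin n → Equiv.Perm (Fin 3)) → Fin 3 → ℝ) (s : Finset (Fin n)) : ℝ :=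
  P (twoRankings s 1 (Equiv.swap 0 2)) 1

/-- The gain of candidate `1` when voter `i` raises it above candidate `0`. -/
def topGain {n : ℕ} (P : (Fin n → Equiv.Perm (Fin 3)) → Fin 3 → ℝ) (s : Finset (Fin n))
    (i : Fin n) : ℝ :=
  P (Function.update (twoRankings s 1 (Equiv.swap 0 2)) i (Equiv.swap 0 1)) 1
    - P (Function.update (twoRankings s 1 (Equiv.swap 0 2)) i 1) 1

theorem sameAbove_update {n : ℕ} {x : Fin 3} {s : Finset (Fin n)} {i : Fin n}
    {ρ τ ρ' τ' σ σ' : Equiv.Perm (Fin 3)} (h1 : SameAbove x ρ ρ') (h2 : SameAbove x τ τ')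
    (h3 : SameAbove x σ σ') (k : Fin n) :
    SameAbove x (Function.update (twoRankings s ρ τ) i σ k)
      (Function.update (twoRankings s ρ' τ') i σ' k) := by
  by_cases hk : k = i
  · subst hk
    simpa using h3
  · simp only [Function.update_of_ne hk, twoRankings]
    split_ifs
    exacts [h1, h2]

/-- Voter i passes from 2, 1, 0 through 1, 2, 0 to 0, 1, 2. The second move undoes a `topGain`. The
first only exchanges probability between 1 and 2, and the amount can be read off from either
candidate. Localization at 2, then at 1, carries it to other rankings of the remaining voters, where
it becomes the `topGain` of the rotated lotteries. -/
theorem middleProb_insert {n : ℕ} {P : (Fin n → Equiv.Perm (Fin 3)) → Fin 3 → ℝ}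
    (hP : Localized P) {s : Finset (Fin n)} {i : Fin n} (hi : i ∉ s) :
    middleProb P (insert i s) - middleProb P s = topGain (rotate P) s i - topGain P s i := by
  have e1 : twoRankings (insert i s) 1 (Equiv.swap 0 2)
      = Function.update (twoRankings s 1 (Equiv.swap 0 2)) i 1 := by
    funext k
    by_cases hk : k = i
    · subst hk
      simp [twoRankings]
    · simp [twoRankings, hk]
  have e2 : twoRankings s 1 (Equiv.swap 0 2)
      = Function.update (twoRankings s 1 (Equiv.swap 0 2)) i (Equiv.swap 0 2) := by
    rw [eq_comm, Function.update_eq_self_iff]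
    simp [twoRankings, hi]
  -- `c` ranks `1, 2, 0`, and `c * c` ranks `2, 0, 1`.
  obtain ⟨c, hc⟩ : ∃ c : Equiv.Perm (Fin 3), c = (finRotate 3)⁻¹ := ⟨_, rfl⟩
  have e3 : ∀ σ, (fun k => Function.update (twoRankings s 1 (Equiv.swap 0 2)) i σ k * c)
      = Function.update (twoRankings s c (Equiv.swap 0 2 * c)) i (σ * c) := by
    intro σ
    funext k
    by_cases hk : k = i
    · subst hk
      simp
    · simp only [Function.update_of_ne hk, twoRankings]
      split_ifs <;> simp
  have hr : finRotate 3 1 = 2 := by decide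
  have hs : Equiv.swap 0 1 * c = Equiv.swap 0 2 := by rw [hc]; decide
  have g2 : topGain (rotate P) s i
      = P (Function.update (twoRankings s c (Equiv.swap 0 2 * c)) i (Equiv.swap 0 2)) 2
        - P (Function.update (twoRankings s c (Equiv.swap 0 2 * c)) i c) 2 := by
    simp only [topGain, rotate, ← hc, e3, hr, hs, one_mul]
  have m1 : middleProb P (insert i s)
      = P (Function.update (twoRankings s 1 (Equiv.swap 0 2)) i 1) 1 := by rw [middleProb, e1]
  have m2 : middleProb P s
      = P (Function.update (twoRankings s 1 (Equiv.swap 0 2)) i (Equiv.swap 0 2)) 1 := by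
    rw [middleProb, ← e2]
  rw [m1, m2, g2, topGain]
  have q1 : P (Function.update (twoRankings s 1 (Equiv.swap 0 2)) i (Equiv.swap 0 1)) 1
      = P (Function.update (twoRankings s 1 (Equiv.swap 0 2)) i c) 1 :=
    hP.congr (sameAbove_update (by decide) (by decide) (by rw [hc]; decide))
  have swap_eq : ∀ ρ τ, P (Function.update (twoRankings s ρ τ) i (Equiv.swap 0 2)) 0
      = P (Function.update (twoRankings s ρ τ) i c) 0 := fun ρ τ =>
    hP.congr (sameAbove_update (fun _ => Iff.rfl) (fun _ => Iff.rfl) (by rw [hc]; decide))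
  -- The ranking pair of the other voters changes from (012, 210) to (102, 201), keeping the
  -- probability of 2, and in `q3` to (120, 021), keeping that of 1.
  have q2 : ∀ σ, P (Function.update (twoRankings s (Equiv.swap 0 1) (finRotate 3)) i σ) 2
      = P (Function.update (twoRankings s 1 (Equiv.swap 0 2)) i σ) 2 := fun σ =>
    hP.congr (sameAbove_update (by decide) (by decide) (fun _ => Iff.rfl))
  have q3 : ∀ σ, P (Function.update (twoRankings s (Equiv.swap 0 1) (finRotate 3)) i σ) 1
      = P (Function.update (twoRankings s c (Equiv.swap 0 2 * c)) i σ) 1 := fun σ =>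
    hP.congr (sameAbove_update (by rw [hc]; decide) (by rw [hc]; decide) (fun _ => Iff.rfl))
  linarith [hP.sum_eq (Function.update (twoRankings s 1 (Equiv.swap 0 2)) i c),
    hP.sum_eq (Function.update (twoRankings s 1 (Equiv.swap 0 2)) i (Equiv.swap 0 2)),
    hP.sum_eq (Function.update (twoRankings s (Equiv.swap 0 1) (finRotate 3)) i c),
    hP.sum_eq (Function.update (twoRankings s (Equiv.swap 0 1) (finRotate 3)) i (Equiv.swap 0 2)),
    hP.sum_eq (Function.update (twoRankings s c (Equiv.swap 0 2 * c)) i c),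
    hP.sum_eq (Function.update (twoRankings s c (Equiv.swap 0 2 * c)) i (Equiv.swap 0 2)),
    swap_eq 1 (Equiv.swap 0 2), swap_eq (Equiv.swap 0 1) (finRotate 3),
    swap_eq c (Equiv.swap 0 2 * c), q2 c, q2 (Equiv.swap 0 2), q3 c, q3 (Equiv.swap 0 2)]

/-- The increments from `middleProb_insert` cancel cyclically, since three rotations give the
identity. -/
theorem sum_middleProb {n : ℕ} {P : (Fin n → Equiv.Perm (Fin 3)) → Fin 3 → ℝ}
    (hP : Localized P) (s t : Finset (Fin n)) :
    middleProb P s + middleProb (rotate P) s + middleProb (rotate (rotate P)) s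
      = middleProb P t + middleProb (rotate P) t + middleProb (rotate (rotate P)) t := by
  have key : ∀ s : Finset (Fin n),
      middleProb P s + middleProb (rotate P) s + middleProb (rotate (rotate P)) s
      = middleProb P ∅ + middleProb (rotate P) ∅ + middleProb (rotate (rotate P)) ∅ := by
    intro s
    induction s using Finset.induction_on with
    | empty => rfl
    | insert i s hi ih =>
      have h1 := middleProb_insert hP hi
      have h2 := middleProb_insert hP.rotate hi
      have h3 := middleProb_insert hP.rotate.rotate hi
      rw [rotate_rotate_rotate] at h3
      linarith
  rw [key s, key t]

/-! ### Welfare inequalities and the bound for ordinal mechanisms -/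

/-- The lotteries `P` yield the fraction `r` of the optimal welfare for ballots with second value
in `[0, 1]`. -/
def Achieves {n : ℕ} (P : (Fin n → Equiv.Perm (Fin 3)) → Fin 3 → ℝ) (r : ℝ) : Prop :=
  ∀ (R : Fin n → Equiv.Perm (Fin 3)) (x : Fin 3), ∀ a ∈ Set.Icc (0 : ℝ) 1,
    r * ∑ i, (![1, a, 0] : Fin 3 → ℝ) (R i x)
      ≤ ∑ j, P R j * ∑ i, (![1, a, 0] : Fin 3 → ℝ) (R i j)

/-- The lottery does not vary with a, so the inequality is continuous in a and extends to the
endpoints 0 and 1, the only values used later. -/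
theorem Ordinal.achieves {n : ℕ} [NeZero n] {J : Mechanism 3 n} (hJ : Ordinal J) :
    Achieves (rankProb J) (ratio J) := by
  intro R x a ha
  have hcont : ∀ k : Fin 3, Continuous fun a : ℝ => (![1, a, 0] : Fin 3 → ℝ) k := by
    intro k
    fin_cases k <;> simp <;> fun_prop
  have hcl : IsClosed {a : ℝ | ratio J * ∑ i, (![1, a, 0] : Fin 3 → ℝ) (R i x)
      ≤ ∑ j, rankProb J R j * ∑ i, (![1, a, 0] : Fin 3 → ℝ) (R i j)} :=
    isClosed_le (continuous_const.mul (continuous_finsetSum _ fun i _ => hcont _))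
      (continuous_finsetSum _ fun j _ => continuous_const.mul
        (continuous_finsetSum _ fun i _ => hcont _))
  refine closure_minimal (s := Set.Ioo (0 : ℝ) 1) (fun b hb => ?_) hcl ?_
  · have key := ratio_mul_welfare_le J (fun i => ballot (R i) b hb) x
    rw [expect, hJ.eq_rankProb R _ fun k j l => ballot_lt_iff _ _ _ _ _] at key
    exact key
  · rwa [closure_Ioo (by norm_num)]

theorem Achieves.rotate {n : ℕ} {P : (Fin n → Equiv.Perm (Fin 3)) → Fin 3 → ℝ} {r : ℝ}
    (h : Achieves P r) : Achieves (rotate P) r := by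
  intro R x a ha
  have key := h (fun i => R i * (finRotate 3)⁻¹) (finRotate 3 x) a ha
  rw [← Equiv.sum_comp (finRotate 3)] at key
  simpa [Voting.rotate] using key

section Bounds

variable {n : ℕ} {P : (Fin n → Equiv.Perm (Fin 3)) → Fin 3 → ℝ} {r : ℝ}

theorem swap_zero_two_apply :
    Equiv.swap (0 : Fin 3) 2 0 = 2 ∧ Equiv.swap (0 : Fin 3) 2 1 = 1 ∧
      Equiv.swap (0 : Fin 3) 2 2 = 0 := by decide

theorem swap_zero_one_apply :
    Equiv.swap (0 : Fin 3) 1 0 = 1 ∧ Equiv.swap (0 : Fin 3) 1 1 = 0 ∧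
      Equiv.swap (0 : Fin 3) 1 2 = 2 := by decide

/-- The voters outside the last block. -/
def frontBlocks (n k h : ℕ) : Finset (Fin n) := Finset.univ.filter fun i => block k h i ≠ 2

theorem sum_twoRankings {k h l : ℕ} (hn : n = k + h + l) (f : Equiv.Perm (Fin 3) → ℝ)
    (ρ τ : Equiv.Perm (Fin 3)) :
    ∑ i, f (twoRankings (frontBlocks n k h) ρ τ i) = (k + h) * f ρ + l * f τ := by
  have h1 : ∀ i, f (twoRankings (frontBlocks n k h) ρ τ i)
      = (fun t : Fin 3 => if t ≠ 2 then f ρ else f τ) (block k h i) := by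
    intro i
    simp only [twoRankings, frontBlocks, Finset.mem_filter, Finset.mem_univ, true_and]
    split_ifs <;> rfl
  rw [Finset.sum_congr rfl fun i _ => h1 i,
    sum_block hn fun t : Fin 3 => if t ≠ 2 then f ρ else f τ]
  simp
  ring

theorem Achieves.top_bound (hA : Achieves P r) {k h l : ℕ} (hn : n = k + h + l) :
    r * (k + h) ≤ P (twoRankings (frontBlocks n k h) 1 (Equiv.swap 0 2)) 0 * (k + h)
      + P (twoRankings (frontBlocks n k h) 1 (Equiv.swap 0 2)) 2 * l := by
  obtain ⟨s0, s1, s2⟩ := swap_zero_two_apply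
  have key := hA (twoRankings (frontBlocks n k h) 1 (Equiv.swap 0 2)) 0 0 (by norm_num)
  simp only [Fin.sum_univ_three] at key
  simp only [fun x => sum_twoRankings hn (fun σ => (![1, 0, 0] : Fin 3 → ℝ) (σ x))] at key
  simpa [s0, s1, s2] using key

theorem Achieves.middle_bound (hA : Achieves P r) (hP : Localized P) {k h l : ℕ}
    (hn : n = k + h + l) {c : ℝ} (h1 : (k + h : ℝ) ≤ c) (h2 : (l : ℝ) ≤ c) :
    r * n ≤ middleProb P (frontBlocks n k h) * n
      + (1 - middleProb P (frontBlocks n k h)) * c := by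
  obtain ⟨s0, s1, s2⟩ := swap_zero_two_apply
  have hn' : (n : ℝ) = k + h + l := by rw [hn]; push_cast; ring
  have key := hA (twoRankings (frontBlocks n k h) 1 (Equiv.swap 0 2)) 1 1 (by norm_num)
  simp only [Fin.sum_univ_three] at key
  simp only [fun x => sum_twoRankings hn (fun σ => (![1, 1, 0] : Fin 3 → ℝ) (σ x))] at key
  simp [s0, s1, s2] at key
  rw [middleProb, hn']
  set R := twoRankings (frontBlocks n k h) 1 (Equiv.swap 0 2)
  have hs := hP.sum_eq R
  have b0 := mul_le_mul_of_nonneg_left h1 (hP.nonneg R 0)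
  have b2 := mul_le_mul_of_nonneg_left h2 (hP.nonneg R 2)
  have : 1 - P R 1 = P R 0 + P R 2 := by linarith
  rw [this]
  linarith

/-- By localization, the voters ranking 2 last may divide their first places between 0 and 1 without
changing the probability of 2. This lowers the welfare of both rivals. -/
theorem Achieves.bottom_bound (hA : Achieves P r) (hP : Localized P) {k h l : ℕ}
    (hn : n = k + h + l) {c : ℝ} (h1 : (k : ℝ) ≤ c) (h2 : (h : ℝ) ≤ c) :
    r * l ≤ P (twoRankings (frontBlocks n k h) 1 (Equiv.swap 0 2)) 2 * l
      + (1 - P (twoRankings (frontBlocks n k h) 1 (Equiv.swap 0 2)) 2) * c := by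
  obtain ⟨s0, s1, s2⟩ := swap_zero_two_apply
  obtain ⟨t0, t1, t2⟩ := swap_zero_one_apply
  let θ : Fin 3 → Equiv.Perm (Fin 3) := ![1, Equiv.swap 0 1, Equiv.swap 0 2]
  have hcongr : P (fun i => θ (block k h i)) 2
      = P (twoRankings (frontBlocks n k h) 1 (Equiv.swap 0 2)) 2 := by
    refine hP.congr fun i => ?_
    simp only [twoRankings, frontBlocks, Finset.mem_filter, Finset.mem_univ, true_and]
    generalize block k h i = t
    revert t
    decide
  have key := hA (fun i => θ (block k h i)) 2 0 (by norm_num)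
  simp only [Fin.sum_univ_three] at key
  simp only [fun x => sum_block hn (fun t => (![1, 0, 0] : Fin 3 → ℝ) (θ t x))] at key
  simp [θ, s0, s1, s2, t0, t1, t2] at key
  rw [← hcongr]
  set R := fun i => θ (block k h i)
  have hs := hP.sum_eq R
  have b0 := mul_le_mul_of_nonneg_left h1 (hP.nonneg R 0)
  have b1 := mul_le_mul_of_nonneg_left h2 (hP.nonneg R 1)
  have : 1 - P R 2 = P R 0 + P R 1 := by linarith
  rw [this]
  simp only [R, θ] at *
  linarith

end Bounds

/-- For large N the hypotheses read m ≥ 2r - 1, q ≥ (0.46r - 0.27)/0.19 and 0.54r ≤ 0.54(1 - m) -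
0.08q. At r = 0.6595 the first two give 0.319 and about 0.175; the constants 318/1000 and 16/100
leave room for rounding. -/
theorem ratio_bound_of_means {r m q N l : ℝ} (hN : 1000 ≤ N) (hl1 : 46 / 100 * N - 1 ≤ l)
    (hl2 : l ≤ 46 / 100 * N) (hm : 0 ≤ m) (hq : 0 ≤ q)
    (htop : r * (N - l) ≤ (1 - m - q) * (N - l) + q * l)
    (hmid : r * N ≤ m * N + (1 - m) * ((N + 1) / 2))
    (hbot : r * l ≤ q * l + (1 - q) * ((N - l + 1) / 2)) : r ≤ 6595 / 10000 := by
  by_contra hr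
  push Not at hr
  have hm1 : 318 / 1000 ≤ m := by
    by_contra hlt
    push Not at hlt
    nlinarith
  have hq1 : 16 / 100 ≤ q := by
    by_contra hlt
    push Not at hlt
    nlinarith
  nlinarith

theorem ratio_le_of_truthful_ordinal {n : ℕ} [NeZero n] (hn : 1000 ≤ n) {J : Mechanism 3 n}
    (hT : Truthful J) (hJ : Ordinal J) : ratio J ≤ 6595 / 10000 := by
  -- A share of 46% is below one half, so electing candidate 2 loses welfare, yet far enough above
  -- 27% for `bottom_bound` to force its election with positive probability.
  obtain ⟨l, hl⟩ : ∃ l, l = 46 * n / 100 := ⟨_, rfl⟩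
  obtain ⟨k, hk⟩ : ∃ k, k = (n - l) / 2 := ⟨_, rfl⟩
  obtain ⟨h, hh⟩ : ∃ h, h = n - l - k := ⟨_, rfl⟩
  obtain ⟨g, hg⟩ : ∃ g, g = n / 2 := ⟨_, rfl⟩
  have hsum : n = k + h + l := by omega
  have hsum' : n = g + 0 + (n - g) := by omega
  have hN : (1000 : ℝ) ≤ n := by exact_mod_cast hn
  have hs : (k : ℝ) + h = n - l := by
    have : (n : ℝ) = k + h + l := by exact_mod_cast hsum
    linarith
  have hkc : (k : ℝ) ≤ (n - l + 1) / 2 := by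
    have : (2 * k + l : ℝ) ≤ n + 1 := by exact_mod_cast (by omega : 2 * k + l ≤ n + 1)
    linarith
  have hhc : (h : ℝ) ≤ (n - l + 1) / 2 := by
    have : (2 * h + l : ℝ) ≤ n + 1 := by exact_mod_cast (by omega : 2 * h + l ≤ n + 1)
    linarith
  have hgc : (g : ℝ) + (0 : ℕ) ≤ (n + 1) / 2 := by
    have : (2 * g : ℝ) ≤ n + 1 := by exact_mod_cast (by omega : 2 * g ≤ n + 1)
    push_cast
    linarith
  have hgc' : ((n - g : ℕ) : ℝ) ≤ (n + 1) / 2 := by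
    have : (2 * (n - g : ℕ) : ℝ) ≤ n + 1 := by exact_mod_cast (by omega : 2 * (n - g) ≤ n + 1)
    linarith
  have hl1 : 46 / 100 * (n : ℝ) - 1 ≤ l := by
    have : (46 * n : ℝ) ≤ 100 * l + 100 := by exact_mod_cast (by omega : 46 * n ≤ 100 * l + 100)
    linarith
  have hl2 : (l : ℝ) ≤ 46 / 100 * n := by
    have : (100 * l : ℝ) ≤ 46 * n := by exact_mod_cast (by omega : 100 * l ≤ 46 * n)
    linarith
  have P0 := hT.localized hJ
  have A0 := hJ.achieves
  have P1 := P0.rotate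
  have A1 := A0.rotate
  have P2 := P1.rotate
  have A2 := A1.rotate
  have t0 := A0.top_bound hsum
  have t1 := A1.top_bound hsum
  have t2 := A2.top_bound hsum
  have b0 := A0.bottom_bound P0 hsum hkc hhc
  have b1 := A1.bottom_bound P1 hsum hkc hhc
  have b2 := A2.bottom_bound P2 hsum hkc hhc
  have m0 := A0.middle_bound P0 hsum' hgc hgc'
  have m1 := A1.middle_bound P1 hsum' hgc hgc'
  have m2 := A2.middle_bound P2 hsum' hgc hgc'
  -- Carries the middle probability from the even split to the 54:46 split.
  have hmid := sum_middleProb P0 (frontBlocks n k h) (frontBlocks n g 0)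
  rw [hs] at t0 t1 t2
  set P := rankProb J
  set R := twoRankings (frontBlocks n k h) 1 (Equiv.swap 0 2)
  have s0 := P0.sum_eq R
  have s1 := P1.sum_eq R
  have s2 := P2.sum_eq R
  have e0 : middleProb P (frontBlocks n k h) = P R 1 := rfl
  have e1 : middleProb (rotate P) (frontBlocks n k h) = rotate P R 1 := rfl
  have e2 : middleProb (rotate (rotate P)) (frontBlocks n k h) = rotate (rotate P) R 1 := rfl
  rw [e0, e1, e2] at hmid
  refine ratio_bound_of_means (N := n) (l := l)
    (m := (P R 1 + rotate P R 1 + rotate (rotate P) R 1) / 3)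
    (q := (P R 2 + rotate P R 2 + rotate (rotate P) R 2) / 3) hN hl1 hl2 ?_ ?_ ?_ ?_ ?_
  · linarith [P0.nonneg R 1, P1.nonneg R 1, P2.nonneg R 1]
  · linarith [P0.nonneg R 2, P1.nonneg R 2, P2.nonneg R 2]
  · have f0 : P R 0 = 1 - P R 1 - P R 2 := by linarith
    have f1 : rotate P R 0 = 1 - rotate P R 1 - rotate P R 2 := by linarith
    have f2 : rotate (rotate P) R 0 = 1 - rotate (rotate P) R 1 - rotate (rotate P) R 2 := by
      linarith
    rw [f0] at t0
    rw [f1] at t1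
    rw [f2] at t2
    linarith
  · rw [hmid]
    linarith
  · linarith

end Voting

end

theorem mainTheorem4 :
    Tendsto (fun k : ℕ => Voting.ratio (Voting.quadraticLottery (k + 1))) atTop
      (𝓝 ((√5 - 1) / 2)) ∧
    (∀ (n : ℕ) [NeZero n], Voting.Truthful (Voting.mixedMechanism n) ∧
      33 / 50 < Voting.ratio (Voting.mixedMechanism n)) ∧
    (∃ δ : ℝ, 0 < δ ∧ ∃ N : ℕ, ∀ (n : ℕ) [NeZero n], N ≤ n →
      ∀ J : Voting.Mechanism 3 n, Voting.Truthful J → Voting.Ordinal J →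
        Voting.ratio J + δ ≤ Voting.ratio (Voting.mixedMechanism n)) := by
  refine ⟨Voting.tendsto_ratio_quadraticLottery,
    fun n _ => ⟨Voting.truthful_mixedMechanism n, Voting.lt_ratio_mixedMechanism n⟩,
    -- The gap 0.6600 - 0.6595.
    1 / 2000, by norm_num, 1000, fun n _ hn J hT hJ => ?_⟩
  have h1 := Voting.ratio_le_of_truthful_ordinal hn hT hJ
  have h2 := Voting.lt_ratio_mixedMechanism n
  linarith
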